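/- Let $X$ and $Y$ be complex Banach spaces and write $B(Y,X)$ for the bounded linear operators from $Y$ to $X$, $B(X)=B(X,X)$. For $T\in B(X)$ let $N(T)$ and $R(T)$ be its kernel and range, and let $\mathrm{asc}(T)$ (resp. $\mathrm{des}(T)$) be the least integer $k\ge 0$ with $N(T^k)=N(T^{k+1})$ (resp. $R(T^k)=R(T^{k+1})$), and $\infty$ if there is no such $k$. The operator $T$ is called - Browder if $\dim N(T)<\infty$, $\dim X/R(T)<\infty$ and $\mathrm{asc}(T)=\mathrm{des}(T)<\infty$; - left semi-Browder if $R(T)$ is closed and complemented in $X$, $\dim N(T)<\infty$ and $\mathrm{asc}(T)<\infty$; - right semi-Browder if $N(T)$ is (closed and) complemented in $X$, $\dim X/R(T)<\infty$ and $\mathrm{des}(T)<\infty$. For $A\in B(X)$, $B\in B(Y)$ and $C\in B(Y,X)$ let $M_C=\begin{pmatrix}A&C\\0&B\end{pmatrix}$ be the operator $(x,y)\mapsto(Ax+Cy,\,By)$ on $X\oplus Y$. **Theorem 2.9.** Let $A\in B(X)$ and $B\in B(Y)$. The following are equivalent: (i) there exists $C\in B(Y,X)$ such that $M_C$ is a Browder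 operator; (ii) (a) $A$ is left semi-Browder, (b) $B$ is right semi-Browder, and (c) $N(A)\times N(B)\cong X/R(A)\times Y/R(B)$, where $\cong$ means that there is a linear homeomorphism between the two spaces. -/

import Mathlib

namespace OperatorMatrix

variable {X Y : Type*} [NormedAddCommGroup X] [NormedSpace ℂ X]
  [NormedAddCommGroup Y] [NormedSpace ℂ Y]

/-- The ascent of `T`: the least `k ≥ 0` with `N(T^k) = N(T^(k+1))`, and `∞` if there is none. -/
noncomputable def ascent (T : X →L[ℂ] X) : ℕ∞ :=
  ⨅ k ∈ {k : ℕ | (T ^ k).ker = (T ^ (k + 1)).ker}, (k : ℕ∞)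

/-- The descent of `T`: the least `k ≥ 0` with `R(T^k) = R(T^(k+1))`, and `∞` if there is none. -/
noncomputable def descent (T : X →L[ℂ] X) : ℕ∞ :=
  ⨅ k ∈ {k : ℕ | (T ^ k).range = (T ^ (k + 1)).range}, (k : ℕ∞)

/-- `T` is Fredholm: `dim N(T) < ∞` and `dim X / R(T) < ∞`
(on a Banach space the range is then automatically closed). -/
def IsFredholmOp (T : X →L[ℂ] X) : Prop :=
  FiniteDimensional ℂ T.ker ∧ FiniteDimensional ℂ (X ⧸ T.range)

/-- `T` is left semi-Fredholm: `R(T)` is a closed and complemented subspace of `X`, that is, the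
range of a continuous linear projection, and `dim N(T) < ∞`. -/
def IsLeftSemiFredholm (T : X →L[ℂ] X) : Prop :=
  T.range.ClosedComplemented ∧ FiniteDimensional ℂ T.ker

/-- `T` is right semi-Fredholm: `N(T)` is a closed and complemented subspace of `X`, and
`dim X / R(T) < ∞`. -/
def IsRightSemiFredholm (T : X →L[ℂ] X) : Prop :=
  T.ker.ClosedComplemented ∧ FiniteDimensional ℂ (X ⧸ T.range)

/-- `T` is Browder: Fredholm with equal, finite ascent and descent. -/
def IsBrowder (T : X →L[ℂ] X) : Prop :=
  IsFredholmOp T ∧ ascent T = descent T ∧ ascent T < ⊤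

/-- `T` is left semi-Browder: left semi-Fredholm with finite ascent. -/
def IsLeftSemiBrowder (T : X →L[ℂ] X) : Prop :=
  IsLeftSemiFredholm T ∧ ascent T < ⊤

/-- `T` is right semi-Browder: right semi-Fredholm with finite descent. -/
def IsRightSemiBrowder (T : X →L[ℂ] X) : Prop :=
  IsRightSemiFredholm T ∧ descent T < ⊤

/-- The upper triangular operator matrix `M_C = [[A, C], [0, B]]` on `X ⊕ Y`:
`M_C (x, y) = (A x + C y, B y)`. -/
def upperTriangular (A : X →L[ℂ] X) (B : Y →L[ℂ] Y) (C : Y →L[ℂ] X) :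
    (X × Y) →L[ℂ] (X × Y) :=
  (A.comp (ContinuousLinearMap.fst ℂ X Y) + C.comp (ContinuousLinearMap.snd ℂ X Y)).prod
    (B.comp (ContinuousLinearMap.snd ℂ X Y))

end OperatorMatrix

/-!
Throughout, finite-dimensional discrepancies are measured by the Fredholm index, on the basis of one
analytic fact, `exists_equiv_of_index_eq_zero`: a bounded Fredholm map of index zero between Banach
spaces differs by a finite-rank map from an isomorphism.

If `M_C` is Browder, its high powers share one kernel and one range, so it has index zero
(`IsAlgFredholm.index_eq_zero`) and is a finite-rank perturbation of an isomorphism. The corners of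
the inverse of that isomorphism invert `A` on the left and `B` on the right modulo finite rank, which
makes `R(A)` and `N(B)` complemented; finiteness of the ascent of `A` and of the descent of `B` is
inherited directly. The operator `C` induces the connecting map `N(B) → X / R(A)` of the snake lemma,
whose index is `dim Y / R(B) - dim N(A)` (`isAlgFredholm_connecting`). It therefore extends by zero
to a map of index zero from `N(A) × N(B)` to `X / R(A) × Y / R(B)`, and the two spaces are
isomorphic.

Conversely, let `p` and `q` be exponents from which the kernels of the powers of `A` and the ranges
of the powers of `B` are constant, and put `X₀ = N(A ^ p)` and `Y₁ = R(B ^ q)`. Then `A⁻¹(X₀) = X₀`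
and `B(Y₁) = Y₁`. Rank-nullity for `A` on `X₀` and for the map induced by `B` on `Y / Y₁` shows
that passing from `X / R(A)` to `X / (R(A) + X₀)` costs `dim N(A)` dimensions
(`finrank_map_mkQ_range`), and passing from `N(B)` to `N(B) ∩ Y₁` costs `dim Y / R(B)`
(`isAlgFredholm_inclusion_ker`). Hence the given isomorphism compresses to a map of index zero from
`N(B) ∩ Y₁` to `X / (R(A) + X₀)`, and these spaces are isomorphic. A `C` that realizes such an
isomorphism makes `M_C` invertible on the middle layer of the flag `X₀ × 0 ≤ X × Y₁ ≤ X × Y`, while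
`M_C` is nilpotent on the two outer, finite-dimensional layers; such an operator is Browder
(`isBrowder_upperTriangular`). No invariant complements are needed.
-/

namespace OperatorMatrix

open Module Submodule

/-! ### Fredholm linear maps and their index -/

section Algebra

variable {𝕜 U V W : Type*} [Field 𝕜] [AddCommGroup U] [Module 𝕜 U] [AddCommGroup V] [Module 𝕜 V]
  [AddCommGroup W] [Module 𝕜 W]

/-- A linear map is algebraically Fredholm if its kernel and its cokernel are finite-dimensional;
no topology is involved. -/
structure IsAlgFredholm (f : U →ₗ[𝕜] V) : Prop where
  finite_ker : FiniteDimensional 𝕜 f.ker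
  finite_coker : FiniteDimensional 𝕜 (V ⧸ f.range)

theorem IsAlgFredholm.comp {g : V →ₗ[𝕜] W} {f : U →ₗ[𝕜] V} (hg : IsAlgFredholm g)
    (hf : IsAlgFredholm f) : IsAlgFredholm (g ∘ₗ f) := by
  have := hg.finite_ker
  have := hg.finite_coker
  have := hf.finite_ker
  have := hf.finite_coker
  constructor
  · rw [LinearMap.ker_comp]; infer_instance
  · rw [LinearMap.range_comp]; infer_instance

theorem IsAlgFredholm.index_comp {g : V →ₗ[𝕜] W} {f : U →ₗ[𝕜] V} (hg : IsAlgFredholm g)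
    (hf : IsAlgFredholm f) : (g ∘ₗ f).index = g.index + f.index := by
  have := hg.finite_ker
  have := hg.finite_coker
  have := hf.finite_ker
  have := hf.finite_coker
  exact LinearMap.index_comp g

theorem IsAlgFredholm.of_surjective {f : U →ₗ[𝕜] V} (hf : Function.Surjective f)
    [FiniteDimensional 𝕜 f.ker] : IsAlgFredholm f := by
  refine ⟨inferInstance, ?_⟩
  rw [LinearMap.range_eq_top.mpr hf]
  infer_instance

theorem IsAlgFredholm.of_injective {f : U →ₗ[𝕜] V} (hf : Function.Injective f)
    [FiniteDimensional 𝕜 (V ⧸ f.range)] : IsAlgFredholm f := by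
  refine ⟨?_, inferInstance⟩
  rw [LinearMap.ker_eq_bot.mpr hf]
  infer_instance

theorem _root_.LinearEquiv.isAlgFredholm (e : U ≃ₗ[𝕜] V) : IsAlgFredholm (e : U →ₗ[𝕜] V) := by
  refine ⟨?_, ?_⟩
  · rw [LinearEquiv.ker]; infer_instance
  · rw [LinearEquiv.range]; infer_instance

variable (𝕜 U V) in
theorem isAlgFredholm_snd [FiniteDimensional 𝕜 U] :
    IsAlgFredholm (LinearMap.snd 𝕜 U V) ∧ (LinearMap.snd 𝕜 U V).index = finrank 𝕜 U := by
  have e : U ≃ₗ[𝕜] (LinearMap.snd 𝕜 U V).ker :=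
    (LinearEquiv.ofInjective _ LinearMap.inl_injective).trans
      (LinearEquiv.ofEq _ _ (LinearMap.range_inl 𝕜 U V))
  have := e.finiteDimensional
  exact ⟨.of_surjective LinearMap.snd_surjective, by
    rw [LinearMap.index_of_surjective LinearMap.snd_surjective, e.finrank_eq]⟩

variable (𝕜 U V) in
theorem isAlgFredholm_fst [FiniteDimensional 𝕜 V] :
    IsAlgFredholm (LinearMap.fst 𝕜 U V) ∧ (LinearMap.fst 𝕜 U V).index = finrank 𝕜 V := by
  have e : V ≃ₗ[𝕜] (LinearMap.fst 𝕜 U V).ker :=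
    (LinearEquiv.ofInjective _ LinearMap.inr_injective).trans
      (LinearEquiv.ofEq _ _ (LinearMap.range_inr 𝕜 U V))
  have := e.finiteDimensional
  exact ⟨.of_surjective LinearMap.fst_surjective, by
    rw [LinearMap.index_of_surjective LinearMap.fst_surjective, e.finrank_eq]⟩

variable (𝕜 U V) in
theorem isAlgFredholm_inr [FiniteDimensional 𝕜 U] :
    IsAlgFredholm (LinearMap.inr 𝕜 U V) ∧ (LinearMap.inr 𝕜 U V).index = -finrank 𝕜 U := by
  have e : ((U × V) ⧸ (LinearMap.inr 𝕜 U V).range) ≃ₗ[𝕜] U :=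
    (quotEquivOfEq _ _ (LinearMap.range_inr 𝕜 U V)).trans
      ((LinearMap.fst 𝕜 U V).quotKerEquivOfSurjective LinearMap.fst_surjective)
  have := e.symm.finiteDimensional
  exact ⟨.of_injective LinearMap.inr_injective, by
    rw [LinearMap.index_of_injective LinearMap.inr_injective, e.finrank_eq]⟩

variable (𝕜 U V) in
theorem isAlgFredholm_inl [FiniteDimensional 𝕜 V] :
    IsAlgFredholm (LinearMap.inl 𝕜 U V) ∧ (LinearMap.inl 𝕜 U V).index = -finrank 𝕜 V := by
  have e : ((U × V) ⧸ (LinearMap.inl 𝕜 U V).range) ≃ₗ[𝕜] V :=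
    (quotEquivOfEq _ _ (LinearMap.range_inl 𝕜 U V)).trans
      ((LinearMap.snd 𝕜 U V).quotKerEquivOfSurjective LinearMap.snd_surjective)
  have := e.symm.finiteDimensional
  exact ⟨.of_injective LinearMap.inl_injective, by
    rw [LinearMap.index_of_injective LinearMap.inl_injective, e.finrank_eq]⟩

theorem finiteDimensional_of_ker {f : U →ₗ[𝕜] V} [FiniteDimensional 𝕜 V]
    [FiniteDimensional 𝕜 f.ker] : FiniteDimensional 𝕜 U := by
  have : FiniteDimensional 𝕜 (U ⧸ f.ker) := f.quotKerEquivRange.symm.finiteDimensional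
  exact Module.Finite.of_submodule_quotient f.ker

theorem finiteDimensional_quotient_of_sup (S F : Submodule 𝕜 U) [FiniteDimensional 𝕜 F]
    (h : FiniteDimensional 𝕜 (U ⧸ (S ⊔ F))) : FiniteDimensional 𝕜 (U ⧸ S) := by
  have : FiniteDimensional 𝕜 ((U ⧸ S) ⧸ F.map S.mkQ) :=
    (quotientQuotientEquivQuotientSup S F).symm.finiteDimensional
  exact Module.Finite.of_submodule_quotient (F.map S.mkQ)

theorem finrank_map_add_finrank_inf_ker (f : U →ₗ[𝕜] V) (S : Submodule 𝕜 U)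
    [FiniteDimensional 𝕜 S] :
    finrank 𝕜 (S.map f) + finrank 𝕜 (S ⊓ f.ker : Submodule 𝕜 U) = finrank 𝕜 S := by
  have h := (f.domRestrict S).finrank_range_add_finrank_ker
  rw [LinearMap.range_domRestrict, LinearMap.ker_domRestrict] at h
  rw [← h, ← (comapSubtypeEquivOfLe (inf_le_left : S ⊓ f.ker ≤ S)).finrank_eq, comap_inf,
    comap_subtype_self, top_inf_eq]

/-- Dividing `U / R(f)` by the image of a finite-dimensional `S` with `f⁻¹(S) = S` costs exactly
`dim N(f)` dimensions, since the restriction of `f` to `S` has index zero. -/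
theorem finrank_map_mkQ_range (f : U →ₗ[𝕜] U) (S : Submodule 𝕜 U) [FiniteDimensional 𝕜 S]
    (hS : S.comap f = S) : finrank 𝕜 (S.map f.range.mkQ) = finrank 𝕜 f.ker := by
  have h₁ := finrank_map_add_finrank_inf_ker f S
  have h₂ := finrank_map_add_finrank_inf_ker f.range.mkQ S
  have hk : S ⊓ f.ker = f.ker := inf_eq_right.mpr fun x hx => by
    rw [← hS, mem_comap, LinearMap.mem_ker.mp hx]; exact zero_mem S
  have hr : S ⊓ f.range = S.map f := by
    conv_rhs => rw [← hS]
    rw [map_comap_eq, inf_comm]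
  rw [ker_mkQ, hr] at h₂
  rw [hk] at h₁
  omega

/-- If `f` maps the finite-codimensional subspace `S` onto itself, then `N(f) ⊓ S` has codimension
`dim U / R(f)` in `N(f)`: the map induced by `f` on the finite-dimensional space `U / S` has index
zero. -/
theorem isAlgFredholm_inclusion_ker (f : U →ₗ[𝕜] U) (S : Submodule 𝕜 U)
    [FiniteDimensional 𝕜 (U ⧸ S)] (hS : S.map f = S) :
    IsAlgFredholm (inclusion (inf_le_left : f.ker ⊓ S ≤ f.ker)) ∧
      (inclusion (inf_le_left : f.ker ⊓ S ≤ f.ker)).index = -finrank 𝕜 (U ⧸ f.range) := by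
  set j := inclusion (inf_le_left : f.ker ⊓ S ≤ f.ker)
  have hSr : S ≤ f.range := by rw [← hS]; exact LinearMap.map_le_range
  let g : (U ⧸ S) →ₗ[𝕜] (U ⧸ S) := S.mapQ S f (map_le_iff_le_comap.mp hS.le)
  have hker : g.ker = f.ker.map S.mkQ := by
    have h1 : S.comap f = f.ker ⊔ S := by
      conv_lhs => rw [← hS]
      rw [comap_map_eq, sup_comm]
    rw [ker_mapQ, h1, Submodule.map_sup, mkQ_map_self, sup_bot_eq]
  have hcoker : ((U ⧸ S) ⧸ g.range) ≃ₗ[𝕜] (U ⧸ f.range) :=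
    (quotEquivOfEq _ _ (range_mapQ _ _ _ _)).trans (quotientQuotientEquivQuotient S f.range hSr)
  let r : f.ker →ₗ[𝕜] (U ⧸ S) := S.mkQ ∘ₗ f.ker.subtype
  have hjr : j.range = r.ker := by
    rw [range_inclusion, LinearMap.ker_comp, ker_mkQ, comap_inf]; simp
  have hr : r.range = g.ker := by rw [hker, LinearMap.range_comp, range_subtype]
  have e : (f.ker ⧸ j.range) ≃ₗ[𝕜] g.ker :=
    (quotEquivOfEq _ _ hjr).trans (r.quotKerEquivRange.trans (LinearEquiv.ofEq _ _ hr))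
  have := e.symm.finiteDimensional
  have hind : g.index = 0 := by rw [LinearMap.index_eq_of_finiteDimensional, sub_self]
  rw [LinearMap.index_eq_finrank_sub, hcoker.finrank_eq, ← e.finrank_eq] at hind
  exact ⟨.of_injective (inclusion_injective _), by
    rw [LinearMap.index_of_injective (inclusion_injective _)]; omega⟩

theorem IsAlgFredholm.pow {f : U →ₗ[𝕜] U} (hf : IsAlgFredholm f) (n : ℕ) :
    IsAlgFredholm (f ^ n) := by
  induction n with
  | zero => exact (LinearEquiv.refl 𝕜 U).isAlgFredholm
  | succ n ih => rw [pow_succ']; exact hf.comp ih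

theorem finiteDimensional_ker_pow (f : U →ₗ[𝕜] U) [FiniteDimensional 𝕜 f.ker] (n : ℕ) :
    FiniteDimensional 𝕜 (f ^ n).ker := by
  induction n with
  | zero => rw [pow_zero, Module.End.one_eq_id, LinearMap.ker_id]; infer_instance
  | succ n ih => rw [pow_succ', Module.End.mul_eq_comp, LinearMap.ker_comp]; infer_instance

theorem finiteDimensional_coker_pow (f : U →ₗ[𝕜] U) [FiniteDimensional 𝕜 (U ⧸ f.range)] (n : ℕ) :
    FiniteDimensional 𝕜 (U ⧸ (f ^ n).range) := by
  induction n with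
  | zero => rw [pow_zero, Module.End.one_eq_id, LinearMap.range_id]; infer_instance
  | succ n ih => rw [pow_succ', Module.End.mul_eq_comp, LinearMap.range_comp]; infer_instance

theorem ker_pow_stable {f : U →ₗ[𝕜] U} {p : ℕ} (h : (f ^ p).ker = (f ^ (p + 1)).ker) {n : ℕ}
    (hn : p ≤ n) : (f ^ n).ker = (f ^ p).ker := by
  induction n, hn using Nat.le_induction with
  | base => rfl
  | succ n hn ih =>
    rw [pow_succ, Module.End.mul_eq_comp, LinearMap.ker_comp, ih, ← LinearMap.ker_comp,
      ← Module.End.mul_eq_comp, ← pow_succ, h]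

theorem range_pow_stable {f : U →ₗ[𝕜] U} {p : ℕ} (h : (f ^ p).range = (f ^ (p + 1)).range)
    {n : ℕ} (hn : p ≤ n) : (f ^ n).range = (f ^ p).range := by
  induction n, hn using Nat.le_induction with
  | base => rfl
  | succ n hn ih =>
    rw [pow_succ', Module.End.mul_eq_comp, LinearMap.range_comp, ih, ← LinearMap.range_comp,
      ← Module.End.mul_eq_comp, ← pow_succ', h]

/-- A Fredholm endomorphism of finite ascent and descent has index zero: its high powers all share
one kernel and one range, while the index is additive. -/
theorem IsAlgFredholm.index_eq_zero {f : U →ₗ[𝕜] U} (hf : IsAlgFredholm f) {p q : ℕ}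
    (hp : (f ^ p).ker = (f ^ (p + 1)).ker) (hq : (f ^ q).range = (f ^ (q + 1)).range) :
    f.index = 0 := by
  have h := hf.index_comp (hf.pow (p + q))
  rw [← Module.End.mul_eq_comp, ← pow_succ', LinearMap.index_eq_finrank_sub (f := f ^ (p + q + 1)),
    LinearMap.index_eq_finrank_sub (f := f ^ (p + q)), ker_pow_stable hp (by omega),
    ker_pow_stable hp (by omega : p ≤ p + q), range_pow_stable hq (by omega),
    range_pow_stable hq (by omega : q ≤ p + q)] at h
  omega

/-- If both chains stabilize, they stabilize from the same exponent on. -/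
theorem ker_pow_eq_succ_iff_range_pow_eq_succ {f : U →ₗ[𝕜] U} {p q : ℕ}
    (hp : (f ^ p).ker = (f ^ (p + 1)).ker) (hq : (f ^ q).range = (f ^ (q + 1)).range) (k : ℕ) :
    (f ^ k).ker = (f ^ (k + 1)).ker ↔ (f ^ k).range = (f ^ (k + 1)).range := by
  constructor <;> intro hk
  · refine le_antisymm ?_ ?_
    · rintro _ ⟨u, rfl⟩
      -- Every vector `u` lies in `R(f)` modulo `N(f ^ (k + q))`, which is `N(f ^ k)`.
      have hu : (f ^ (k + q)) u ∈ (f ^ (k + q + 1)).range := by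
        rw [range_pow_stable hq (by omega), ← range_pow_stable hq (by omega : q ≤ k + q)]
        exact ⟨u, rfl⟩
      obtain ⟨w, hw⟩ := hu
      have hd : u - f w ∈ (f ^ (k + q)).ker := by
        rw [LinearMap.mem_ker, map_sub, ← hw, pow_succ, Module.End.mul_apply, sub_self]
      rw [ker_pow_stable hk (by omega), LinearMap.mem_ker, map_sub, sub_eq_zero] at hd
      exact ⟨w, by rw [pow_succ, Module.End.mul_apply, hd]⟩
    · rw [pow_succ, Module.End.mul_eq_comp]; exact LinearMap.range_comp_le_range _ _
  · refine le_antisymm ?_ ?_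
    · rw [pow_succ', Module.End.mul_eq_comp]; exact LinearMap.ker_le_ker_comp _ _
    · intro x hx
      have hx' : (f ^ k) x ∈ (f ^ (k + p)).range := by
        rw [range_pow_stable hk (by omega)]; exact ⟨x, rfl⟩
      obtain ⟨z, hz⟩ := hx'
      have h0 : z ∈ (f ^ (k + p + 1)).ker := by
        rw [LinearMap.mem_ker] at hx ⊢
        rw [pow_succ', Module.End.mul_apply, hz, ← Module.End.mul_apply, ← pow_succ', hx]
      rw [ker_pow_stable hp (by omega), ← ker_pow_stable hp (by omega : p ≤ k + p),
        LinearMap.mem_ker, hz] at h0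
      exact h0

end Algebra

/-! ### Fredholm operators and complemented subspaces of Banach spaces -/

section Banach

variable {E F : Type*} [NormedAddCommGroup E] [NormedSpace ℂ E] [CompleteSpace E]
  [NormedAddCommGroup F] [NormedSpace ℂ F] [CompleteSpace F]

/-- A Fredholm operator of index zero between Banach spaces is a finite-rank perturbation of an
isomorphism: the correction sends the kernel isomorphically onto a complement of the range. -/
theorem exists_equiv_of_index_eq_zero (T : E →L[ℂ] F) (hT : IsAlgFredholm (T : E →ₗ[ℂ] F))
    (h0 : (T : E →ₗ[ℂ] F).index = 0) :
    ∃ (e : E ≃L[ℂ] F) (K : E →L[ℂ] F), FiniteDimensional ℂ K.range ∧ ∀ x, e x = T x + K x := by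
  have := hT.finite_ker
  have := hT.finite_coker
  obtain ⟨P, hP⟩ := ClosedComplemented.of_finiteDimensional T.ker
  obtain ⟨W, hW⟩ := T.range.exists_isCompl
  have eW := T.range.quotientEquivOfIsCompl W hW
  have := eW.finiteDimensional
  have hfin : finrank ℂ T.ker = finrank ℂ W := by
    rw [LinearMap.index_eq_finrank_sub, eW.finrank_eq] at h0
    omega
  let a : T.ker ≃ₗ[ℂ] W := LinearEquiv.ofFinrankEq _ _ hfin
  let K : E →L[ℂ] F := W.subtypeL ∘L a.toLinearMap.toContinuousLinearMap ∘L P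
  have hKW (x : E) : K x ∈ W := (a (P x)).2
  have hinj : (T + K).ker = ⊥ := by
    refine (_root_.eq_bot_iff).mpr fun x hx => ?_
    have hx : T x + K x = 0 := hx
    have hTx : T x = 0 := disjoint_def.mp hW.disjoint _ ⟨x, rfl⟩ (by
      rw [eq_neg_of_add_eq_zero_left hx]; exact W.neg_mem (hKW x))
    have hKx : K x = 0 := by simpa [hTx] using hx
    have hPx : P x = 0 := a.map_eq_zero_iff.mp (Subtype.ext hKx)
    have := hP ⟨x, hTx⟩
    rw [hPx] at this
    exact (congrArg Subtype.val this).symm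
  have hsurj : (T + K).range = ⊤ := by
    refine eq_top_iff.mpr fun y _ => ?_
    obtain ⟨_, ⟨x, rfl⟩, w, hw, rfl⟩ := mem_sup.mp (hW.sup_eq_top ▸ mem_top : y ∈ T.range ⊔ W)
    let k : T.ker := a.symm ⟨w, hw⟩ - P x
    refine ⟨x + k, ?_⟩
    have hTk : T (k : E) = 0 := k.2
    have hPk : P (x + k) = a.symm ⟨w, hw⟩ := by rw [map_add, hP]; simp [k]
    have hK : K (x + k) = w := by
      change ((a (P (x + k)) : W) : F) = w
      rw [hPk, a.apply_symm_apply]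
    change T (x + k) + K (x + k) = T x + w
    rw [hK, map_add, hTk, add_zero]
  refine ⟨ContinuousLinearEquiv.ofBijective (T + K) hinj hsurj, K, ?_, fun x => ?_⟩
  · exact Submodule.finiteDimensional_of_le
      (show K.range ≤ W from by rintro _ ⟨x, rfl⟩; exact hKW x)
  · rfl

theorem isClosed_range_of_finiteDimensional_coker (T : E →L[ℂ] F)
    [FiniteDimensional ℂ (F ⧸ T.range)] : IsClosed (T.range : Set F) := by
  have : IsClosed (T.ker : Set E) := T.isClosed_ker
  obtain ⟨W, hW⟩ := T.range.exists_isCompl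
  have := (T.range.quotientEquivOfIsCompl W hW).finiteDimensional
  let S : (E ⧸ T.ker) →L[ℂ] F := T.ker.liftQL T le_rfl
  have hS : S.range = T.range := range_liftQ _ _ _
  rw [← hS] at hW ⊢
  exact S.closed_complemented_range_of_isCompl_of_ker_eq_bot W hW W.closed_of_finiteDimensional
    (ker_liftQ_eq_bot _ _ _ le_rfl)

end Banach

section Complemented

variable {E F : Type*} [NormedAddCommGroup E] [NormedSpace ℂ E] [NormedAddCommGroup F]
  [NormedSpace ℂ F]

/-- An operator that is left invertible modulo finite rank has a complemented range. -/
theorem closedComplemented_range_of_left_inverse (T : E →L[ℂ] F) (S : F →L[ℂ] E) (K : E →L[ℂ] E)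
    [FiniteDimensional ℂ K.range] (h : ∀ x, S (T x) = x - K x) : T.range.ClosedComplemented := by
  let T' : E →L[ℂ] T.range := T.codRestrict _ fun x => ⟨x, rfl⟩
  -- `T ∘ S` restricts to `id - G` on the range of `T`, with `G` of finite rank; extending `G` to
  -- the whole space turns it into a correction that makes `T ∘ S` a projection.
  let G : T.range →L[ℂ] T.range := ContinuousLinearMap.id ℂ _ - T' ∘L S ∘L T.range.subtypeL
  have hG (x : E) : G (T' x) = T' (K x) := by
    have : T' (S (T x)) = T' x - T' (K x) := by rw [h, map_sub]
    change T' x - T' (S (T x)) = _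
    rw [this, sub_sub_cancel]
  have : FiniteDimensional ℂ G.range := by
    refine Submodule.finiteDimensional_of_le (S₂ := K.range.map (T' : E →ₗ[ℂ] T.range)) ?_
    rintro _ ⟨⟨_, x, rfl⟩, rfl⟩
    exact ⟨K x, ⟨x, rfl⟩, (hG x).symm⟩
  obtain ⟨g, hg⟩ := G.exist_extension_of_finiteDimensional_range
  refine ⟨T' ∘L S + g, fun z => ?_⟩
  have hz : g z = z - T' (S z) := (DFunLike.congr_fun hg z).symm
  change T' (S z) + g z = z
  rw [hz, add_sub_cancel]

/-- An operator that is right invertible modulo finite rank has a complemented kernel. -/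
theorem closedComplemented_ker_of_right_inverse (T : E →L[ℂ] F) (S : F →L[ℂ] E) (K : F →L[ℂ] F)
    [FiniteDimensional ℂ K.range] (h : ∀ y, T (S y) = y - K y) : T.ker.ClosedComplemented := by
  -- `id - S ∘ T` fixes the kernel and maps into `L`, where the kernel has finite codimension.
  let L : Submodule ℂ E := K.range.comap (T : E →ₗ[ℂ] F)
  let T' : L →L[ℂ] F := T ∘L L.subtypeL
  have : FiniteDimensional ℂ T'.range := by
    refine Submodule.finiteDimensional_of_le (S₂ := K.range) ?_
    rintro _ ⟨x, rfl⟩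
    exact x.2
  obtain ⟨q, hq⟩ := T'.ker_closedComplemented_of_finiteDimensional_range
  let r : E →L[ℂ] L := (ContinuousLinearMap.id ℂ E - S ∘L T).codRestrict L fun x =>
    ⟨T x, by simp [h]⟩
  let i : T'.ker →L[ℂ] T.ker := (L.subtypeL ∘L T'.ker.subtypeL).codRestrict T.ker fun x => x.2
  refine ⟨i ∘L q ∘L r, fun x => ?_⟩
  have hx : T x = 0 := x.2
  have hxL : (x : E) ∈ L := by
    change T x ∈ K.range
    rw [hx]; exact zero_mem _
  have hr : r x = ⟨x, hxL⟩ := by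
    refine Subtype.ext ?_
    change (x : E) - S (T x) = x
    rw [hx, map_zero, sub_zero]
  have := hq ⟨⟨x, hxL⟩, hx⟩
  change i (q (r x)) = x
  rw [hr, this]
  rfl

theorem _root_.Submodule.ClosedComplemented.sup_finiteDimensional {S : Submodule ℂ E}
    (hS : S.ClosedComplemented) (L : Submodule ℂ E) [FiniteDimensional ℂ L] :
    (S ⊔ L).ClosedComplemented := by
  obtain ⟨f, hf⟩ := hS
  let d : E →L[ℂ] E := ContinuousLinearMap.id ℂ E - S.subtypeL ∘L f
  have hd (x : E) : d x = x - f x := rfl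
  let G : Submodule ℂ E := L.map (d : E →ₗ[ℂ] E)
  obtain ⟨g, hg⟩ := ClosedComplemented.of_finiteDimensional G
  have hG : G ≤ S ⊔ L := by
    rintro _ ⟨l, hl, rfl⟩
    exact sub_mem (mem_sup_right hl) (mem_sup_left (f l).2)
  refine ⟨(S.subtypeL ∘L f + G.subtypeL ∘L g ∘L d).codRestrict _ fun x =>
    add_mem (mem_sup_left (f x).2) (hG (g (d x)).2), ?_⟩
  rintro ⟨x, hx⟩
  obtain ⟨s, hs, l, hl, rfl⟩ := mem_sup.mp hx
  have hds : d s = 0 := by rw [hd, hf ⟨s, hs⟩, sub_self]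
  have hdx : d (s + l) ∈ G := ⟨l, hl, by simp [hds]⟩
  refine Subtype.ext ?_
  change (f (s + l) : E) + g (d (s + l)) = s + l
  have hgd : (g (d (s + l)) : E) = d (s + l) := congrArg Subtype.val (hg ⟨_, hdx⟩)
  rw [hgd, hd, add_sub_cancel]

end Complemented

/-! ### Ascent and descent -/

section AscentDescent

variable {X : Type*} [NormedAddCommGroup X] [NormedSpace ℂ X]

theorem ascent_lt_top_iff {T : X →L[ℂ] X} :
    ascent T < ⊤ ↔ ∃ k : ℕ, (T ^ k).ker = (T ^ (k + 1)).ker := by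
  simp [ascent, iInf_lt_iff]

theorem descent_lt_top_iff {T : X →L[ℂ] X} :
    descent T < ⊤ ↔ ∃ k : ℕ, (T ^ k).range = (T ^ (k + 1)).range := by
  simp [descent, iInf_lt_iff]

theorem ascent_eq_descent {T : X →L[ℂ] X} (ha : ascent T < ⊤) (hd : descent T < ⊤) :
    ascent T = descent T := by
  obtain ⟨p, hp⟩ := ascent_lt_top_iff.mp ha
  obtain ⟨q, hq⟩ := descent_lt_top_iff.mp hd
  simp only [ContinuousLinearMap.toLinearMap_pow] at hp hq
  simp only [ascent, descent, ContinuousLinearMap.toLinearMap_pow, Set.mem_ofPred_eq,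
    ker_pow_eq_succ_iff_range_pow_eq_succ hp hq]

end AscentDescent

/-! ### From a Browder completion to the entries -/

section Connecting

variable {𝕜 U V : Type*} [Field 𝕜] [AddCommGroup U] [Module 𝕜 U] [AddCommGroup V] [Module 𝕜 V]

/-- If `m = [[a, c], [0, b]]` is Fredholm, then the map `N(b) → U / R(a)` induced by `c` is
Fredholm and its index is determined by that of `m`. This is the connecting map of the snake lemma:
`N(m)` is an extension of its kernel by `N(a)`, and `(U × V) / R(m)` is an extension of `V / R(b)`
by its cokernel. -/
theorem isAlgFredholm_connecting {a : U →ₗ[𝕜] U} {b : V →ₗ[𝕜] V} {c : V →ₗ[𝕜] U}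
    {m : U × V →ₗ[𝕜] U × V} (hm : ∀ z, m z = (a z.1 + c z.2, b z.2)) (hF : IsAlgFredholm m) :
    FiniteDimensional 𝕜 a.ker ∧ FiniteDimensional 𝕜 (V ⧸ b.range) ∧
      IsAlgFredholm (a.range.mkQ ∘ₗ c ∘ₗ b.ker.subtype) ∧
      (a.range.mkQ ∘ₗ c ∘ₗ b.ker.subtype).index =
        m.index - finrank 𝕜 a.ker + finrank 𝕜 (V ⧸ b.range) := by
  have := hF.finite_ker
  have := hF.finite_coker
  set d := a.range.mkQ ∘ₗ c ∘ₗ b.ker.subtype with hd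
  have hd0 (y : b.ker) : d y = 0 ↔ ∃ x, a x = c y := by
    rw [hd, LinearMap.comp_apply, mkQ_apply, Quotient.mk_eq_zero, LinearMap.mem_range]; rfl
  let i : a.ker →ₗ[𝕜] m.ker := (LinearMap.inl 𝕜 U V ∘ₗ a.ker.subtype).codRestrict m.ker
    fun x => by
      have hx : a x = 0 := x.2
      simp [hm, hx]
  have hi : Function.Injective i := fun x x' h =>
    Subtype.ext (congrArg (fun z : m.ker => (z : U × V).1) h)
  have hz (z : m.ker) : a (z : U × V).1 + c (z : U × V).2 = 0 ∧ b (z : U × V).2 = 0 := by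
    have h : m z = 0 := z.2
    rwa [hm, Prod.mk_eq_zero] at h
  let r : m.ker →ₗ[𝕜] d.ker :=
    ((LinearMap.snd 𝕜 U V ∘ₗ m.ker.subtype).codRestrict b.ker fun z => (hz z).2).codRestrict d.ker
      fun z => (hd0 _).mpr ⟨-(z : U × V).1, by
        rw [map_neg]; exact neg_eq_of_add_eq_zero_right (hz z).1⟩
  have hr : Function.Surjective r := by
    rintro ⟨y, hy⟩
    obtain ⟨x, hx⟩ := (hd0 y).mp hy
    have hy' : b y = 0 := y.2
    exact ⟨⟨(-x, y), by simp [hm, hx, hy']⟩, rfl⟩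
  have hir : i.range = r.ker := by
    ext z
    constructor
    · rintro ⟨x, rfl⟩
      rfl
    · intro h
      have h2 : (z : U × V).2 = 0 := congrArg (fun y : d.ker => ((y : b.ker) : V)) h
      have h1 := (hz z).1
      rw [h2, map_zero, add_zero] at h1
      exact ⟨⟨_, h1⟩, Subtype.ext (Prod.ext rfl h2.symm)⟩
  have hfa : FiniteDimensional 𝕜 a.ker := .of_injective i hi
  have hfd : FiniteDimensional 𝕜 d.ker := .of_surjective r hr
  have hkdim := r.finrank_range_add_finrank_ker
  rw [LinearMap.range_eq_top.mpr hr, finrank_top, ← hir, LinearMap.finrank_range_of_inj hi] at hkdim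
  let φ : (U ⧸ a.range) →ₗ[𝕜] ((U × V) ⧸ m.range) :=
    a.range.liftQ (m.range.mkQ ∘ₗ LinearMap.inl 𝕜 U V) (by
      rintro _ ⟨x, rfl⟩
      rw [LinearMap.mem_ker, LinearMap.comp_apply, mkQ_apply, Quotient.mk_eq_zero]
      exact ⟨(x, 0), by simp [hm]⟩)
  let ψ : ((U × V) ⧸ m.range) →ₗ[𝕜] (V ⧸ b.range) :=
    m.range.mapQ b.range (LinearMap.snd 𝕜 U V) (by
      rintro _ ⟨z, rfl⟩
      exact ⟨z.2, by simp [hm]⟩)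
  have hψ : Function.Surjective ψ := by
    intro y
    obtain ⟨y, rfl⟩ := mkQ_surjective _ y
    exact ⟨m.range.mkQ (0, y), rfl⟩
  have hφ : φ.ker = d.range := by
    ext u
    obtain ⟨u, rfl⟩ := mkQ_surjective _ u
    have h1 : a.range.mkQ u ∈ φ.ker ↔ (u, (0 : V)) ∈ m.range := by
      rw [← Submodule.Quotient.mk_eq_zero m.range]; rfl
    rw [h1]
    constructor
    · rintro ⟨⟨x, y⟩, h⟩
      obtain ⟨h1, h2⟩ := Prod.mk.inj ((hm _).symm.trans h)
      exact ⟨⟨y, h2⟩, (Submodule.Quotient.eq _).mpr ⟨-x, by simp [← h1]⟩⟩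
    · rintro ⟨y, h⟩
      obtain ⟨x, hx⟩ := (Submodule.Quotient.eq _).mp h
      have hy : b y = 0 := y.2
      exact ⟨(-x, y), by rw [hm, hy, map_neg, hx]; simp⟩
  have hφψ : φ.range = ψ.ker := by
    ext z
    constructor
    · rintro ⟨u, rfl⟩
      obtain ⟨u, rfl⟩ := mkQ_surjective _ u
      exact (Quotient.mk_eq_zero _).mpr (zero_mem _)
    · intro h
      obtain ⟨⟨u, v⟩, rfl⟩ := mkQ_surjective _ z
      obtain ⟨y, hy : b y = v⟩ := (Quotient.mk_eq_zero _).mp h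
      refine ⟨a.range.mkQ (u - c y), (Submodule.Quotient.eq _).mpr ⟨(0, -y), ?_⟩⟩
      rw [hm, ← hy]; simp
  have e : ((U ⧸ a.range) ⧸ d.range) ≃ₗ[𝕜] ψ.ker :=
    (quotEquivOfEq _ _ hφ.symm).trans (φ.quotKerEquivRange.trans (LinearEquiv.ofEq _ _ hφψ))
  have hfb : FiniteDimensional 𝕜 (V ⧸ b.range) := .of_surjective ψ hψ
  have hcdim := ψ.finrank_range_add_finrank_ker
  rw [LinearMap.range_eq_top.mpr hψ, finrank_top, ← e.finrank_eq] at hcdim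
  refine ⟨hfa, hfb, ⟨hfd, e.symm.finiteDimensional⟩, ?_⟩
  rw [LinearMap.index_eq_finrank_sub, LinearMap.index_eq_finrank_sub]
  omega

end Connecting

variable {X Y : Type*} [NormedAddCommGroup X] [NormedSpace ℂ X]
  [NormedAddCommGroup Y] [NormedSpace ℂ Y]
  {A : X →L[ℂ] X} {B : Y →L[ℂ] Y} {C : Y →L[ℂ] X}

theorem upperTriangular_apply (z : X × Y) :
    upperTriangular A B C z = (A z.1 + C z.2, B z.2) := rfl

theorem upperTriangular_pow_apply_inl (n : ℕ) (x : X) :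
    (upperTriangular A B C ^ n) (x, 0) = ((A ^ n) x, 0) := by
  induction n generalizing x with
  | zero => rfl
  | succ n ih =>
    rw [pow_succ, mul_apply_eq_comp, upperTriangular_apply, map_zero, map_zero,
      add_zero, ih, pow_succ, mul_apply_eq_comp]

theorem upperTriangular_pow_apply_snd (n : ℕ) (z : X × Y) :
    ((upperTriangular A B C ^ n) z).2 = (B ^ n) z.2 := by
  induction n generalizing z with
  | zero => rfl
  | succ n ih =>
    rw [pow_succ, mul_apply_eq_comp, ih, upperTriangular_apply, pow_succ,
      mul_apply_eq_comp]

theorem ascent_lt_top_of_upperTriangular (h : ascent (upperTriangular A B C) < ⊤) :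
    ascent A < ⊤ := by
  obtain ⟨k, hk⟩ := ascent_lt_top_iff.mp h
  refine ascent_lt_top_iff.mpr ⟨k, le_antisymm (fun x hx => ?_) fun x hx => ?_⟩
  · rw [LinearMap.mem_ker, ContinuousLinearMap.coe_coe] at hx ⊢
    rw [pow_succ', mul_apply_eq_comp, hx, map_zero]
  · rw [LinearMap.mem_ker, ContinuousLinearMap.coe_coe] at hx
    have h1 : (x, (0 : Y)) ∈ (upperTriangular A B C ^ (k + 1)).ker := by
      rw [LinearMap.mem_ker, ContinuousLinearMap.coe_coe, upperTriangular_pow_apply_inl, hx]; rfl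
    rw [← hk, LinearMap.mem_ker, ContinuousLinearMap.coe_coe, upperTriangular_pow_apply_inl] at h1
    exact congrArg Prod.fst h1

theorem descent_lt_top_of_upperTriangular (h : descent (upperTriangular A B C) < ⊤) :
    descent B < ⊤ := by
  obtain ⟨k, hk⟩ := descent_lt_top_iff.mp h
  refine descent_lt_top_iff.mpr ⟨k, le_antisymm ?_ ?_⟩
  · rintro _ ⟨y, rfl⟩
    have h1 : (upperTriangular A B C ^ k) (0, y) ∈ (upperTriangular A B C ^ (k + 1)).range := by
      rw [← hk]; exact ⟨_, rfl⟩
    obtain ⟨w, hw⟩ := h1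
    refine ⟨w.2, ?_⟩
    have h2 := congrArg Prod.snd hw
    rwa [ContinuousLinearMap.coe_coe, upperTriangular_pow_apply_snd,
      upperTriangular_pow_apply_snd] at h2
  · rintro _ ⟨y, rfl⟩
    exact ⟨B y, by rw [pow_succ]; rfl⟩

theorem semiBrowder_of_isBrowder_upperTriangular [CompleteSpace X] [CompleteSpace Y]
    (h : IsBrowder (upperTriangular A B C)) :
    IsLeftSemiBrowder A ∧ IsRightSemiBrowder B ∧
      Nonempty ((A.ker × B.ker) ≃L[ℂ] ((X ⧸ A.range) × (Y ⧸ B.range))) := by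
  set M := upperTriangular A B C with hM
  obtain ⟨⟨hker, hcoker⟩, had, ha⟩ := h
  have hd : descent M < ⊤ := had ▸ ha
  have hF : IsAlgFredholm (M : X × Y →ₗ[ℂ] X × Y) := ⟨hker, hcoker⟩
  obtain ⟨p, hp⟩ := ascent_lt_top_iff.mp ha
  obtain ⟨q, hq⟩ := descent_lt_top_iff.mp hd
  simp only [ContinuousLinearMap.toLinearMap_pow] at hp hq
  have hM0 := hF.index_eq_zero hp hq
  obtain ⟨e, K, hK, he⟩ := exists_equiv_of_index_eq_zero M hF hM0
  obtain ⟨hfA, hfB, hδ, hδi⟩ := isAlgFredholm_connecting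
    (a := (A : X →ₗ[ℂ] X)) (b := (B : Y →ₗ[ℂ] Y)) (c := (C : Y →ₗ[ℂ] X))
    (m := (M : X × Y →ₗ[ℂ] X × Y)) (fun _ => rfl) hF
  -- The corners of the inverse of `e` invert `A` and `B` on one side, modulo finite rank.
  have hA : A.range.ClosedComplemented := by
    let S : X →L[ℂ] X := ContinuousLinearMap.fst ℂ X Y ∘L (e.symm : X × Y →L[ℂ] X × Y) ∘L
      ContinuousLinearMap.inl ℂ X Y
    let P : X × Y →L[ℂ] X := ContinuousLinearMap.fst ℂ X Y ∘L (e.symm : X × Y →L[ℂ] X × Y)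
    have : FiniteDimensional ℂ (P ∘L K ∘L ContinuousLinearMap.inl ℂ X Y).range := by
      refine Submodule.finiteDimensional_of_le (S₂ := K.range.map (P : X × Y →ₗ[ℂ] X)) ?_
      rintro _ ⟨x, rfl⟩
      exact ⟨_, ⟨(x, 0), rfl⟩, rfl⟩
    refine closedComplemented_range_of_left_inverse A S (P ∘L K ∘L ContinuousLinearMap.inl ℂ X Y)
      fun x => ?_
    have hx : (A x, (0 : Y)) = e (x, 0) - K (x, 0) := by
      rw [he, add_sub_cancel_right, hM, upperTriangular_apply]; simp
    change (e.symm (A x, 0)).1 = x - (e.symm (K (x, 0))).1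
    rw [hx, map_sub, e.symm_apply_apply, Prod.fst_sub]
  have hB : B.ker.ClosedComplemented := by
    let S : Y →L[ℂ] Y := ContinuousLinearMap.snd ℂ X Y ∘L (e.symm : X × Y →L[ℂ] X × Y) ∘L
      ContinuousLinearMap.inr ℂ X Y
    let J : Y →L[ℂ] X × Y := (e.symm : X × Y →L[ℂ] X × Y) ∘L ContinuousLinearMap.inr ℂ X Y
    have : FiniteDimensional ℂ (ContinuousLinearMap.snd ℂ X Y ∘L K ∘L J).range := by
      refine Submodule.finiteDimensional_of_le (S₂ := K.range.map (LinearMap.snd ℂ X Y)) ?_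
      rintro _ ⟨y, rfl⟩
      exact ⟨_, ⟨J y, rfl⟩, rfl⟩
    refine closedComplemented_ker_of_right_inverse B S (ContinuousLinearMap.snd ℂ X Y ∘L K ∘L J)
      fun y => ?_
    have hy : M (J y) = (0, y) - K (J y) := by
      rw [eq_sub_iff_add_eq, ← he]; exact e.apply_symm_apply _
    exact congrArg Prod.snd hy
  have hfA' : FiniteDimensional ℂ A.ker := hfA
  have hfB' : FiniteDimensional ℂ (Y ⧸ B.range) := hfB
  refine ⟨⟨⟨hA, hfA⟩, ascent_lt_top_of_upperTriangular ha⟩,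
    ⟨⟨hB, hfB⟩, descent_lt_top_of_upperTriangular hd⟩, ?_⟩
  have hAc : IsClosed (A.range : Set X) := hA.isClosed
  have hBc : IsClosed (B.range : Set Y) := isClosed_range_of_finiteDimensional_coker B
  let T : (A.ker × B.ker) →L[ℂ] ((X ⧸ A.range) × (Y ⧸ B.range)) :=
    ContinuousLinearMap.inl ℂ _ _ ∘L (A.range.mkQL ∘L C ∘L B.ker.subtypeL) ∘L
      ContinuousLinearMap.snd ℂ _ _
  obtain ⟨h1, i1⟩ := isAlgFredholm_snd ℂ A.ker B.ker
  obtain ⟨h2, i2⟩ := isAlgFredholm_inl ℂ (X ⧸ A.range) (Y ⧸ B.range)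
  have hT : IsAlgFredholm (T : (A.ker × B.ker) →ₗ[ℂ] ((X ⧸ A.range) × (Y ⧸ B.range))) :=
    h2.comp (hδ.comp h1)
  have hTi : (T : (A.ker × B.ker) →ₗ[ℂ] ((X ⧸ A.range) × (Y ⧸ B.range))).index = 0 := by
    refine (h2.index_comp (hδ.comp h1)).trans ?_
    rw [hδ.index_comp h1, i1, i2, hδi, hM0]
    ring
  obtain ⟨E, -⟩ := exists_equiv_of_index_eq_zero T hT hTi
  exact ⟨E⟩

/-! ### Construction of a Browder completion -/

section BlockTriangular

variable {X Y : Type*} [NormedAddCommGroup X] [NormedSpace ℂ X]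
  [NormedAddCommGroup Y] [NormedSpace ℂ Y]
  {A : X →L[ℂ] X} {B : Y →L[ℂ] Y} {C : Y →L[ℂ] X}

/-- Consider the flag `X₀ × 0 ≤ X × Y₁ ≤ X × Y`, where `X₀` is finite-dimensional with `A` nilpotent
on it, and `Y₁` is finite-codimensional with `B` nilpotent modulo it. If `A` is injective modulo
`X₀`, `B` maps `Y₁` onto itself, and `C` maps `N(B) ⊓ Y₁` isomorphically onto `X / (R(A) + X₀)`,
then `M_C` is invertible on the middle layer of the flag, and hence Browder. -/
theorem isBrowder_upperTriangular (X₀ : Submodule ℂ X) (Y₁ : Submodule ℂ Y)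
    [FiniteDimensional ℂ X₀] [FiniteDimensional ℂ (Y ⧸ Y₁)]
    (hX₀ : X₀.comap (A : X →ₗ[ℂ] X) = X₀) (hY₁ : Y₁.map (B : Y →ₗ[ℂ] Y) = Y₁) {p q : ℕ}
    (hAp : ∀ x ∈ X₀, (A ^ p) x = 0) (hBq : ∀ y, (B ^ q) y ∈ Y₁)
    (hC₁ : ∀ y ∈ B.ker ⊓ Y₁, C y ∈ A.range ⊔ X₀ → y = 0)
    (hC₂ : ∀ x, ∃ y ∈ B.ker ⊓ Y₁, x - C y ∈ A.range ⊔ X₀) :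
    IsBrowder (upperTriangular A B C) := by
  set M := upperTriangular A B C with hM
  let N : Submodule ℂ (X × Y) := X₀.map (LinearMap.inl ℂ X Y)
  have hN {x : X} {y : Y} : (x, y) ∈ N ↔ x ∈ X₀ ∧ y = 0 := by
    constructor
    · rintro ⟨x', hx', h⟩
      obtain ⟨rfl, rfl⟩ := Prod.mk.inj h
      exact ⟨hx', rfl⟩
    · rintro ⟨hx, rfl⟩
      exact ⟨x, hx, rfl⟩
  have hMN {z : X × Y} (hz : z ∈ N) : M z ∈ N := by
    obtain ⟨x, hx, rfl⟩ := hz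
    have hAx : A x ∈ X₀ := by rw [← hX₀] at hx; exact hx
    exact hN.mpr ⟨by simpa using hAx, map_zero B⟩
  have hMY {z : X × Y} (hz : z.2 ∈ Y₁) : (M z).2 ∈ Y₁ := hY₁.le ⟨_, hz, rfl⟩
  -- `M` is injective on `X × Y₁` modulo `X₀ × 0`, and so are its powers.
  have hinj (n : ℕ) {z : X × Y} (hz : z.2 ∈ Y₁) (h : (M ^ n) z ∈ N) : z ∈ N := by
    induction n generalizing z with
    | zero => exact h
    | succ n ih =>
      rw [pow_succ, mul_apply_eq_comp] at h
      obtain ⟨x, y⟩ := z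
      obtain ⟨hx, hy⟩ := hN.mp (ih (hMY hz) h)
      have hCy : C y ∈ A.range ⊔ X₀ := by
        rw [← add_sub_cancel_left (A x) (C y)]
        exact sub_mem (mem_sup_right hx) (mem_sup_left ⟨x, rfl⟩)
      have hy0 : y = 0 := hC₁ y ⟨hy, hz⟩ hCy
      refine hN.mpr ⟨?_, hy0⟩
      rw [← hX₀]
      simpa [hy0] using hx
  -- `M` maps `X × Y₁` onto itself modulo `X₀ × 0`, and so do its powers.
  have hsurj (n : ℕ) {z : X × Y} (hz : z.2 ∈ Y₁) : ∃ w : X × Y, w.2 ∈ Y₁ ∧ z - (M ^ n) w ∈ N := by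
    induction n generalizing z with
    | zero => exact ⟨z, hz, by simp⟩
    | succ n ih =>
      obtain ⟨x, y⟩ := z
      obtain ⟨y', hy', rfl⟩ := hY₁.ge hz
      obtain ⟨y'', ⟨hBy'', hy''⟩, h⟩ := hC₂ (x - C y')
      obtain ⟨_, ⟨x', rfl⟩, x₀, hx₀, h⟩ := mem_sup.mp h
      have hBy : B y'' = 0 := hBy''
      obtain ⟨w, hw, hwN⟩ := ih (z := (x', y' + y'')) (add_mem hy' hy'')
      refine ⟨w, hw, ?_⟩
      have h1 : (x, B y') - M (x', y' + y'') ∈ N := by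
        refine hN.mpr ⟨?_, by
          change B y' - B (y' + y'') = 0
          rw [map_add, hBy, add_zero, sub_self]⟩
        have : x - (A x' + C (y' + y'')) = x₀ := by
          rw [map_add, sub_add_eq_sub_sub_swap, ← sub_sub, ← h]; simp
        exact this ▸ hx₀
      have h2 := add_mem h1 (hMN hwN)
      rwa [map_sub, sub_add_sub_cancel, ← mul_apply_eq_comp, ← pow_succ'] at h2
  have hMp {z : X × Y} (hz : z ∈ N) : (M ^ p) z = 0 := by
    obtain ⟨x, hx, rfl⟩ := hz
    exact (upperTriangular_pow_apply_inl p x).trans (by rw [hAp x hx]; rfl)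
  have hMq (z : X × Y) : ((M ^ q) z).2 ∈ Y₁ := by
    rw [hM, upperTriangular_pow_apply_snd]; exact hBq _
  have hker : FiniteDimensional ℂ M.ker := by
    let f : M.ker →ₗ[ℂ] (Y ⧸ Y₁) := Y₁.mkQ ∘ₗ LinearMap.snd ℂ X Y ∘ₗ M.ker.subtype
    let g : f.ker →ₗ[ℂ] N := (M.ker.subtype ∘ₗ f.ker.subtype).codRestrict N fun z => by
      have hz : M (z : M.ker) = 0 := (z : M.ker).2
      refine hinj 1 ((Submodule.Quotient.mk_eq_zero _).mp z.2) ?_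
      rw [pow_one]
      exact hz ▸ zero_mem N
    have : FiniteDimensional ℂ f.ker := .of_injective g fun z w h =>
      Subtype.ext (Subtype.ext (congrArg (Subtype.val : N → X × Y) h))
    exact finiteDimensional_of_ker (f := f)
  have hcoker : FiniteDimensional ℂ ((X × Y) ⧸ M.range) := by
    refine finiteDimensional_quotient_of_sup _ N
      (CoFG.of_le ?_ (CoFG.ker (Y₁.mkQ ∘ₗ LinearMap.snd ℂ X Y)))
    intro z hz
    obtain ⟨w, -, hw⟩ := hsurj 1 ((Submodule.Quotient.mk_eq_zero _).mp hz)
    rw [pow_one] at hw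
    rw [← add_sub_cancel (M w) z]
    exact add_mem (mem_sup_left ⟨w, rfl⟩) (mem_sup_right hw)
  have hasc : ascent M < ⊤ := by
    refine ascent_lt_top_iff.mpr ⟨p + q, le_antisymm (fun z hz => ?_) fun z hz => ?_⟩
    · rw [LinearMap.mem_ker, ContinuousLinearMap.coe_coe] at hz ⊢
      rw [pow_succ', mul_apply_eq_comp, hz, map_zero]
    · rw [LinearMap.mem_ker, ContinuousLinearMap.coe_coe] at hz ⊢
      rw [add_right_comm, pow_add, mul_apply_eq_comp] at hz
      rw [pow_add, mul_apply_eq_comp]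
      exact hMp (hinj (p + 1) (hMq z) (hz ▸ zero_mem N))
  have hdesc : descent M < ⊤ := by
    refine descent_lt_top_iff.mpr ⟨p + q, le_antisymm ?_ ?_⟩
    · rintro _ ⟨z, rfl⟩
      obtain ⟨w, -, hw⟩ := hsurj (q + 1) (hMq z)
      refine ⟨w, ?_⟩
      have h := hMp hw
      rw [map_sub, sub_eq_zero] at h
      rw [ContinuousLinearMap.coe_coe, ContinuousLinearMap.coe_coe, add_assoc,
        pow_add M p (q + 1), pow_add M p q, mul_apply_eq_comp, mul_apply_eq_comp, h]
    · rintro _ ⟨z, rfl⟩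
      exact ⟨M z, by rw [pow_succ]; rfl⟩
  exact ⟨⟨hker, hcoker⟩, ascent_eq_descent hasc hdesc, hasc⟩

theorem exists_isBrowder_upperTriangular [CompleteSpace X] [CompleteSpace Y]
    (hA : IsLeftSemiBrowder A) (hB : IsRightSemiBrowder B)
    (θ : (A.ker × B.ker) ≃L[ℂ] ((X ⧸ A.range) × (Y ⧸ B.range))) :
    ∃ C : Y →L[ℂ] X, IsBrowder (upperTriangular A B C) := by
  obtain ⟨⟨hAr, hAk⟩, hAa⟩ := hA
  obtain ⟨⟨⟨f, hf⟩, hBr⟩, hBd⟩ := hB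
  obtain ⟨p, hp⟩ := ascent_lt_top_iff.mp hAa
  obtain ⟨q, hq⟩ := descent_lt_top_iff.mp hBd
  set X₀ : Submodule ℂ X := (A ^ p).ker with hX₀def
  set Y₁ : Submodule ℂ Y := (B ^ q).range with hY₁def
  have hX₀ : X₀.comap (A : X →ₗ[ℂ] X) = X₀ := by
    conv_rhs => rw [hp, pow_succ]
    rfl
  have hY₁ : Y₁.map (B : Y →ₗ[ℂ] Y) = Y₁ := by
    conv_rhs => rw [hq, pow_succ']
    exact (LinearMap.range_comp _ _).symm
  have hfX₀ : FiniteDimensional ℂ X₀ := by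
    rw [hX₀def, ContinuousLinearMap.toLinearMap_pow]
    exact finiteDimensional_ker_pow _ p
  have hfY₁ : FiniteDimensional ℂ (Y ⧸ Y₁) := by
    rw [hY₁def, ContinuousLinearMap.toLinearMap_pow]
    exact finiteDimensional_coker_pow _ q
  -- `V` represents `X / (R(A) + X₀)`, and `σ` is the quotient map.
  obtain ⟨V, hV⟩ := (hAr.sup_finiteDimensional X₀).exists_isTopCompl
  let σ : X →L[ℂ] V := V.projectionOntoL (A.range ⊔ X₀) hV.symm
  have hσ : (σ : X →ₗ[ℂ] V).ker = A.range ⊔ X₀ := ker_projectionOntoL hV.symm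
  have hσV (v : V) : σ v = v := projectionOntoL_apply_left hV.symm v
  have hVc : IsClosed (V : Set X) := hV.isClosed'
  have := hVc.completeSpace_coe
  obtain ⟨hι, hιi⟩ := isAlgFredholm_inclusion_ker (B : Y →ₗ[ℂ] Y) Y₁ hY₁
  set N : Submodule ℂ Y := B.ker ⊓ Y₁ with hN
  have hNc : IsClosed (N : Set Y) :=
    B.isClosed_ker.inter (isClosed_range_of_finiteDimensional_coker (B ^ q))
  have := hNc.completeSpace_coe
  obtain ⟨P, hP⟩ : N.ClosedComplemented := by
    have hcl : IsClosed ((N.comap B.ker.subtype : Submodule ℂ B.ker) : Set B.ker) :=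
      hNc.preimage continuous_subtype_val
    have hfin : FiniteDimensional ℂ (B.ker ⧸ N.comap B.ker.subtype) := by
      have := hι.finite_coker
      rwa [range_inclusion] at this
    obtain ⟨g, hg⟩ := ClosedComplemented.of_finiteDimensional_quotient hcl
    refine ⟨(B.ker.subtypeL ∘L (N.comap B.ker.subtype).subtypeL ∘L g ∘L f).codRestrict N
      fun y => (g (f y)).2, fun y => Subtype.ext ?_⟩
    have h1 : f y = ⟨y, y.2.1⟩ := hf ⟨y, y.2.1⟩
    have h2 := hg ⟨⟨y, y.2.1⟩, y.2⟩
    change ((g (f y) : B.ker) : Y) = y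
    rw [h1, h2]
  let s : (X ⧸ A.range) →L[ℂ] V := A.range.liftQL σ (hσ.symm ▸ le_sup_left)
  have hssurj : Function.Surjective (s : (X ⧸ A.range) →ₗ[ℂ] V) := fun v =>
    ⟨A.range.mkQ v, hσV v⟩
  have hsker : (s : (X ⧸ A.range) →ₗ[ℂ] V).ker = X₀.map A.range.mkQ := by
    refine (ker_liftQ _ _ _).trans ?_
    rw [hσ, Submodule.map_sup, mkQ_map_self, bot_sup_eq]
  have hsfin : FiniteDimensional ℂ (s : (X ⧸ A.range) →ₗ[ℂ] V).ker := by
    rw [hsker]; infer_instance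
  have hs : IsAlgFredholm (s : (X ⧸ A.range) →ₗ[ℂ] V) := .of_surjective hssurj
  have hsi : (s : (X ⧸ A.range) →ₗ[ℂ] V).index = finrank ℂ A.ker := by
    rw [LinearMap.index_of_surjective hssurj, hsker]
    exact_mod_cast finrank_map_mkQ_range (A : X →ₗ[ℂ] X) X₀ hX₀
  obtain ⟨h₁, i₁⟩ := isAlgFredholm_inr ℂ A.ker B.ker
  obtain ⟨h₂, i₂⟩ := isAlgFredholm_fst ℂ (X ⧸ A.range) (Y ⧸ B.range)
  have hθ := θ.toLinearEquiv.isAlgFredholm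
  -- The factors have index `-dim Y / R(B)`, `-dim N(A)`, `0`, `dim Y / R(B)` and `dim N(A)`, from the
  -- innermost outwards.
  let D : N →L[ℂ] V := s ∘L ContinuousLinearMap.fst ℂ _ _ ∘L
    (θ : (A.ker × B.ker) →L[ℂ] ((X ⧸ A.range) × (Y ⧸ B.range))) ∘L
    ContinuousLinearMap.inr ℂ _ _ ∘L N.subtypeL.codRestrict B.ker fun y => y.2.1
  have hD : IsAlgFredholm (D : N →ₗ[ℂ] V) := hs.comp (h₂.comp (hθ.comp (h₁.comp hι)))
  have hDi : (D : N →ₗ[ℂ] V).index = 0 := by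
    refine (hs.index_comp (h₂.comp (hθ.comp (h₁.comp hι)))).trans ?_
    rw [h₂.index_comp (hθ.comp (h₁.comp hι)), hθ.index_comp (h₁.comp hι), h₁.index_comp hι, i₁, i₂,
      hιi, hsi, LinearEquiv.index_eq_zero]
    ring
  obtain ⟨e, -⟩ := exists_equiv_of_index_eq_zero D hD hDi
  refine ⟨V.subtypeL ∘L (e : N →L[ℂ] V) ∘L P, isBrowder_upperTriangular X₀ Y₁ hX₀ hY₁ (p := p)
    (q := q) (fun x hx => hx) (fun y => ⟨y, rfl⟩) (fun y hy h => ?_) fun x => ?_⟩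
  · have hPy : P y = ⟨y, hy⟩ := hP ⟨y, hy⟩
    have h' : ((e (P y) : V) : X) = 0 := disjoint_def.mp hV.isCompl.disjoint _ h (e (P y)).2
    have h0 : P y = 0 := e.map_eq_zero_iff.mp (Subtype.ext h')
    exact congrArg Subtype.val (hPy.symm.trans h0)
  · refine ⟨e.symm (σ x), (e.symm (σ x)).2, ?_⟩
    change x - ((e (P (e.symm (σ x) : N)) : V) : X) ∈ _
    rw [hP, e.apply_symm_apply, ← hσ, LinearMap.mem_ker, map_sub]
    exact sub_eq_zero.mpr (hσV (σ x)).symm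

end BlockTriangular

end OperatorMatrix

theorem theorem2p9 {X Y : Type*}
    [NormedAddCommGroup X] [NormedSpace ℂ X] [CompleteSpace X]
    [NormedAddCommGroup Y] [NormedSpace ℂ Y] [CompleteSpace Y]
    (A : X →L[ℂ] X) (B : Y →L[ℂ] Y) :
    (∃ C : Y →L[ℂ] X, OperatorMatrix.IsBrowder (OperatorMatrix.upperTriangular A B C)) ↔
      (OperatorMatrix.IsLeftSemiBrowder A ∧
        OperatorMatrix.IsRightSemiBrowder B ∧
        Nonempty ((A.ker × B.ker) ≃L[ℂ] ((X ⧸ A.range) × (Y ⧸ B.range)))) :=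
  ⟨fun ⟨_, hC⟩ => OperatorMatrix.semiBrowder_of_isBrowder_upperTriangular hC,
    fun ⟨hA, hB, ⟨θ⟩⟩ => OperatorMatrix.exists_isBrowder_upperTriangular hA hB θ⟩
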